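/- Let $\mathcal H$ be a complex Hilbert space, $\mathcal L_0\subset\mathcal H$ a closed subspace with orthogonal projection $P_0$, and let $Z=Z^*$ be a bounded self-adjoint operator on $\mathcal H$ which is co-diagonal with respect to $\mathcal L_0\oplus\mathcal L_0^\perp$, i.e. $Z\mathcal L_0\subset\mathcal L_0^\perp$ and $Z\mathcal L_0^\perp\subset\mathcal L_0$. Thus $\delta(t)=e^{itZ}\mathcal L_0$ ($t\in\mathbb R$) is a geodesic of the Grassmann manifold of $\mathcal H$ with $\delta(0)=\mathcal L_0$. An operator $T$ on a Hilbert space $E$ is Schmidt decomposable if there are orthonormal systems $(f_i)_{i\in I}$, $(g_i)_{i\in I}$ in $E$ and numbers $s_i>0$ with $Th=\sum_{i\in I}s_i\langle h,g_i\rangle f_i$ for all $h\in E$ (the inner product being linear in the first variable). Operators are (simultaneously) diagonalizable if the space has an orthonormal basis of (common) eigenvectors. Let $\mathbf{Sd}_{\mathcal L_0}$ be the set of unitary operators $U$ on $\mathcal H$ such that $P_0U|_{\mathcal L_0}:\mathcal L_0\to\mathcal L_0$ is Schmidt decomposable. Fix $s\neq 0$ (for instance $s=1$), put $\mathcal L=\delta(s)$,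 and let $$\mathcal H'=\big((\mathcal L_0\cap\mathcal L)\oplus(\mathcal L_0^\perp\cap\mathcal L^\perp)\oplus(\mathcal L_0\cap\mathcal L^\perp)\oplus(\mathcal L_0^\perp\cap\mathcal L)\big)^\perp$$ be the generic part of the pair $\mathcal L_0,\mathcal L$. Then $Z\mathcal H'\subset\mathcal H'$; let $Z'=Z|_{\mathcal H'}$ be the generic part of $Z$. The following are equivalent: 1. $e^{it_0Z}\in\mathbf{Sd}_{\mathcal L_0}$ for some $t_0\in\mathbb R$, $t_0\neq 0$; 2. $e^{itZ}\in\mathbf{Sd}_{\mathcal L_0}$ for all $t\in\mathbb R$; 3. $Z'$ is diagonalizable. In this case all the operators $e^{itZ}$ and all the commutators $[P_0,P_{\delta(t)}]$, $t\in\mathbb R$, are simultaneously diagonalizable. -/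

import Mathlib

universe u

noncomputable section

/-- `T` has a singular value decomposition: there are orthonormal systems `f`, `g` and positive
numbers `s` with `T = ∑ sᵢ fᵢ ⊗ gᵢ`, where `(f ⊗ g) h = ⟪g, h⟫ f` (the Mathlib inner product is
linear in the second variable) and the series converges strongly.  The index set is arbitrary;
in a separable space it is automatically countable. -/
def IsSchmidtDecomposable {E : Type u} [NormedAddCommGroup E] [InnerProductSpace ℂ E]
    (T : E →L[ℂ] E) : Prop :=
  ∃ (ι : Type u) (f g : ι → E) (s : ι → ℝ),
    Orthonormal ℂ f ∧ Orthonormal ℂ g ∧ (∀ i, 0 < s i) ∧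
      ∀ h : E, HasSum (fun i => ((s i : ℂ) * inner ℂ (g i) h) • f i) (T h)

/-- A family of operators is simultaneously diagonalizable: there is an orthonormal basis of the
space consisting of common eigenvectors of all its members. -/
def SimultaneouslyDiagonalizable {E : Type u} [NormedAddCommGroup E] [InnerProductSpace ℂ E]
    (S : Set (E →L[ℂ] E)) : Prop :=
  ∃ (ι : Type u) (b : HilbertBasis ι ℂ E), ∀ T ∈ S, ∀ i, ∃ μ : ℂ, T (b i) = μ • b i

/-- An operator is diagonalizable: there is an orthonormal basis of the space consisting of
eigenvectors of it. -/
def IsDiagonalizable {E : Type u} [NormedAddCommGroup E] [InnerProductSpace ℂ E]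
    (T : E →L[ℂ] E) : Prop :=
  ∃ (ι : Type u) (b : HilbertBasis ι ℂ E), ∀ i, ∃ μ : ℂ, T (b i) = μ • b i

variable {H : Type u} [NormedAddCommGroup H] [InnerProductSpace ℂ H]

/-- The compression `P_K T|_K : K → K` of `T` to the closed subspace `K`. -/
def compression (K : Submodule ℂ H) [K.HasOrthogonalProjection] (T : H →L[ℂ] H) : K →L[ℂ] K :=
  K.orthogonalProjectionOnto ∘L T ∘L K.subtypeL

/-- The Halmos generic part of two subspaces:
`H' = (H₁₁ ⊕ H₀₀ ⊕ H₁₀ ⊕ H₀₁)ᗮ`. -/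
def halmosGenericPart (K L : Submodule ℂ H) : Submodule ℂ H :=
  ((K ⊓ L) ⊔ (Kᗮ ⊓ Lᗮ) ⊔ (K ⊓ Lᗮ) ⊔ (Kᗮ ⊓ L))ᗮ

/-- `Z` is co-diagonal with respect to the decomposition `H = L ⊕ Lᗮ`. -/
def IsCodiagonal (L : Submodule ℂ H) (Z : H →L[ℂ] H) : Prop :=
  (∀ x ∈ L, Z x ∈ Lᗮ) ∧ (∀ x ∈ Lᗮ, Z x ∈ L)

variable [CompleteSpace H]

instance (K L : Submodule ℂ H) : (halmosGenericPart K L).HasOrthogonalProjection := by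
  have : CompleteSpace (halmosGenericPart K L) :=
    (Submodule.isClosed_orthogonal _).completeSpace_coe
  exact Submodule.HasOrthogonalProjection.ofCompleteSpace _

/-- The set of all unitary operators `U` such that `P_L U|_L` is Schmidt decomposable in `L`. -/
def Sd (L : Submodule ℂ H) [L.HasOrthogonalProjection] : Set (unitary (H →L[ℂ] H)) :=
  {U | IsSchmidtDecomposable (compression L (U : H →L[ℂ] H))}

/-- The unitary operator `e^{itZ}`. -/
abbrev expItZ (Z : selfAdjoint (H →L[ℂ] H)) (t : ℝ) : unitary (H →L[ℂ] H) :=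
  selfAdjoint.expUnitary (t • Z)

/-- The curve `δ(t) = e^{itZ} L`; the geodesics of the Grassmann manifold starting at `L` are
these curves with `Z` self-adjoint and co-diagonal with respect to `L`. -/
abbrev grassmannGeodesic (L : Submodule ℂ H) (Z : selfAdjoint (H →L[ℂ] H)) (t : ℝ) :
    Submodule ℂ H :=
  L.map ((Unitary.linearIsometryEquiv (expItZ Z t)).toLinearEquiv : H →ₗ[ℂ] H)

/-- The commutator `[P_L, P_{δ(t)}]`. -/
def geodesicCommutator (L : Submodule ℂ H) [L.HasOrthogonalProjection]
    (Z : selfAdjoint (H →L[ℂ] H)) (t : ℝ) : H →L[ℂ] H :=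
  ⁅L.starProjection, (grassmannGeodesic L Z t).starProjection⁆

/-- The generic part `Z'` of `Z`: its part in the Halmos generic part of `L` and `δ(s)`. -/
def exponentGenericPart (L : Submodule ℂ H) (Z : selfAdjoint (H →L[ℂ] H)) (s : ℝ) :
    halmosGenericPart L (grassmannGeodesic L Z s) →L[ℂ]
      halmosGenericPart L (grassmannGeodesic L Z s) :=
  compression _ (Z : H →L[ℂ] H)

end

/-! All three conditions are equivalent to totality of the eigenvectors of `Z`, i.e. `(eigenspan Z)ᗮ
= ⊥`. The symmetry `J = 2P₀ - 1` anticommutes with `Z`, so `J e^{itZ} J = e^{-itZ}`. Hence `e^{itZ}`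
compresses to `cos(tZ)` on `L₀`, and `[P₀, P_{δ(t)}] = -(i/2) sin(2tZ)` (`geodesicCommutator_eq`).

Eigenvectors are recovered from these functions by `mem_eigenspan_of_trigonometric`: a nonzero
trigonometric polynomial has finitely many zeros on the compact spectrum, so a vector it annihilates
is a finite sum of eigenvectors of `Z`.

If the compression at `t ≠ 0` is Schmidt decomposable, the eigenvectors of its square are total in
`L₀` and lie in `eigenspan Z`; co-diagonality then carries totality from `L₀` to the whole space. If
`Z'` is diagonalizable, only the non-generic pieces remain: the commutator vanishes there, so they
lie in `eigenspan Z`. Conversely, totality diagonalizes `Z`, and with it every `e^{itZ}`, every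
commutator, the compressions and `Z'`. -/

/-! ### Functional calculus and spans of eigenvectors -/

/-- If `g` vanishes at the spectral zeros of `f`, then `f(Z) v = 0` implies `g(Z) v = 0`. -/
lemma ContinuousLinearMap.cfc_apply_eq_zero_of_zeros_subset {H : Type*} [NormedAddCommGroup H]
    [InnerProductSpace ℂ H] [CompleteSpace H] {Z : H →L[ℂ] H} [IsStarNormal Z]
    {f g : ℂ → ℂ} (hf : ContinuousOn f (spectrum ℂ Z)) (hg : ContinuousOn g (spectrum ℂ Z))
    (hfg : ∀ z ∈ spectrum ℂ Z, f z = 0 → g z = 0) {v : H} (hv : cfc f Z v = 0) :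
    cfc g Z v = 0 := by
  have hK : IsCompact (spectrum ℂ Z) := spectrum.isCompact Z
  have hf2 : ContinuousOn (fun z => ‖f z‖ ^ 2) (spectrum ℂ Z) := hf.norm.pow 2
  -- Division of `g` by `f` is regularized: `h = g * conj f / (|f|² + δ)` makes `h * f` uniformly
  -- close to `g`, while `(h * f)(Z) v = h(Z) f(Z) v = 0`.
  have key : ∀ ε : ℝ, 0 < ε → ‖cfc g Z v‖ ≤ ε * ‖v‖ := by
    intro ε hε
    obtain ⟨m, hm, hmle⟩ : ∃ m : ℝ, 0 < m ∧ ∀ z ∈ spectrum ℂ Z, ε ≤ ‖g z‖ → m ≤ ‖f z‖ ^ 2 := by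
      have hc : IsCompact (spectrum ℂ Z ∩ (fun z => ‖g z‖) ⁻¹' Set.Ici ε) :=
        hK.of_isClosed_subset
          (hg.norm.preimage_isClosed_of_isClosed hK.isClosed isClosed_Ici) Set.inter_subset_left
      rcases (spectrum ℂ Z ∩ (fun z => ‖g z‖) ⁻¹' Set.Ici ε).eq_empty_or_nonempty with he | hne
      · refine ⟨1, one_pos, fun z hz hgz => ?_⟩
        have : z ∈ spectrum ℂ Z ∩ (fun z => ‖g z‖) ⁻¹' Set.Ici ε := ⟨hz, hgz⟩
        simp [he] at this
      · obtain ⟨z₀, hz₀, hmin⟩ := hc.exists_isMinOn hne (hf2.mono Set.inter_subset_left)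
        refine ⟨‖f z₀‖ ^ 2, ?_, fun z hz hgz => hmin ⟨hz, hgz⟩⟩
        have : f z₀ ≠ 0 := fun h0 => by
          have h1 : ε ≤ ‖g z₀‖ := hz₀.2
          rw [hfg _ hz₀.1 h0, norm_zero] at h1
          exact absurd h1 (not_le.mpr hε)
        positivity
    obtain ⟨M, hM⟩ := hK.exists_bound_of_continuousOn hg
    set M' := max M 0 + 1
    have hM' : 0 < M' := by positivity
    have hMg : ∀ z ∈ spectrum ℂ Z, ‖g z‖ ≤ M' := fun z hz =>
      (hM z hz).trans (by have := le_max_left M 0; linarith)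
    -- The error is `|g| δ / (|f|² + δ)`. Where `|g| ≥ ε` it is at most `M' δ / m = ε`; elsewhere it
    -- is at most `|g| < ε`.
    set δ := m * ε / M'
    have hδ : 0 < δ := by positivity
    set h : ℂ → ℂ := fun z => g z * (starRingEnd ℂ) (f z) / ((‖f z‖ ^ 2 + δ : ℝ) : ℂ)
    have hpos : ∀ z, ((‖f z‖ ^ 2 + δ : ℝ) : ℂ) ≠ 0 := fun z => by
      exact_mod_cast (by positivity : ‖f z‖ ^ 2 + δ ≠ 0)
    have hh : ContinuousOn h (spectrum ℂ Z) := by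
      refine (hg.mul (Complex.continuous_conj.comp_continuousOn hf)).div
        (Complex.continuous_ofReal.comp_continuousOn (hf2.add continuousOn_const))
        fun z _ => hpos z
    have hdiff : ∀ z, g z - h z * f z = g z * δ / ((‖f z‖ ^ 2 + δ : ℝ) : ℂ) := fun z => by
      have h1 : (starRingEnd ℂ) (f z) * f z = ((‖f z‖ ^ 2 : ℝ) : ℂ) := by
        rw [mul_comm, Complex.mul_conj, Complex.normSq_eq_norm_sq]
      have h2 := hpos z
      simp only [h]
      rw [div_mul_eq_mul_div, mul_assoc, h1]
      push_cast at h2 ⊢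
      field_simp
      ring
    have hn : ‖cfc (fun z => g z - h z * f z) Z‖ ≤ ε := by
      refine norm_cfc_le hε.le fun z hz => ?_
      rw [hdiff, norm_div, norm_mul, Complex.norm_real, Complex.norm_real,
        Real.norm_of_nonneg hδ.le, Real.norm_of_nonneg (by positivity), div_le_iff₀ (by positivity)]
      by_cases hgz : ε ≤ ‖g z‖
      · have h1 := hmle z hz hgz
        calc ‖g z‖ * δ ≤ M' * δ := by gcongr; exact hMg z hz
          _ = ε * m := by simp only [δ]; field_simp
          _ ≤ ε * (‖f z‖ ^ 2 + δ) := by gcongr; linarith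
      · push Not at hgz
        calc ‖g z‖ * δ ≤ ε * δ := by gcongr
          _ ≤ ε * (‖f z‖ ^ 2 + δ) := by gcongr; nlinarith [sq_nonneg ‖f z‖]
    have he : cfc g Z v = cfc (fun z => g z - h z * f z) Z v := by
      rw [cfc_sub (fun z => g z) (fun z => h z * f z) Z hg (hh.mul hf), cfc_mul h f Z hh hf]
      simp [hv]
    rw [he]
    exact (ContinuousLinearMap.le_opNorm _ _).trans (by gcongr)
  have h0 : ‖cfc g Z v‖ ≤ 0 := by
    refine le_of_forall_pos_le_add fun ε hε => ?_
    have h1 := key (ε / (‖v‖ + 1)) (by positivity)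
    refine h1.trans ?_
    rw [zero_add, div_mul_eq_mul_div, div_le_iff₀ (by positivity)]
    nlinarith [norm_nonneg v]
  exact norm_le_zero_iff.mp h0

/-- The linear span of all eigenvectors of `T`. -/
def eigenspan {H : Type*} [NormedAddCommGroup H] [InnerProductSpace ℂ H] (T : H →L[ℂ] H) :
    Submodule ℂ H :=
  ⨆ μ : ℂ, Module.End.eigenspace (T : H →ₗ[ℂ] H) μ

lemma mem_eigenspan {H : Type*} [NormedAddCommGroup H] [InnerProductSpace ℂ H] {T : H →L[ℂ] H}
    {v : H} {μ : ℂ} (h : T v = μ • v) : v ∈ eigenspan T :=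
  Submodule.mem_iSup_of_mem μ (Module.End.mem_eigenspace_iff.mpr h)

lemma eigenspan_le {H : Type*} [NormedAddCommGroup H] [InnerProductSpace ℂ H] {T : H →L[ℂ] H}
    {K : Submodule ℂ H} (h : ∀ (v : H) (μ : ℂ), T v = μ • v → v ∈ K) : eigenspan T ≤ K :=
  iSup_le fun μ v hv => h v μ (Module.End.mem_eigenspace_iff.mp hv)

/-- The Lagrange basis polynomials sum to 1 and so split `v`. Multiplied by `X - x`, the one at node
`x` becomes a multiple of the nodal polynomial, so its component of `v` is killed by `T - x`. -/
lemma mem_eigenspan_of_aeval_nodal {H : Type*} [NormedAddCommGroup H] [InnerProductSpace ℂ H]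
    {T : H →L[ℂ] H} (s : Finset ℂ) {v : H}
    (hv : Polynomial.aeval T (Lagrange.nodal s id) v = 0) : v ∈ eigenspan T := by
  classical
  rcases s.eq_empty_or_nonempty with rfl | hs
  · simp only [Lagrange.nodal_empty, map_one, one_apply_eq_self] at hv
    simp [hv]
  have h1 : v = ∑ x ∈ s, Polynomial.aeval T (Lagrange.basis s id x) v := by
    have := congrArg (fun p => Polynomial.aeval T p v)
      (Lagrange.sum_basis (F := ℂ) (s := s) (v := id) Function.injective_id.injOn hs)
    simpa [map_sum, sum_apply] using this.symm
  rw [h1]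
  refine Submodule.sum_mem _ fun x hx => mem_eigenspan (μ := x) ?_
  have h2 : (Polynomial.X - Polynomial.C x) * Lagrange.basis s id x =
      Polynomial.C (Lagrange.nodalWeight s id x) * Lagrange.nodal s id := by
    rw [Lagrange.basis_eq_prod_sub_inv_mul_nodal_div hx,
      ← Lagrange.nodal_erase_eq_nodal_div hx, Lagrange.nodal_eq_mul_nodal_erase hx]
    simp only [id]
    ring
  have h3 := congrArg (fun p => Polynomial.aeval T p v) h2
  simp only [map_mul, map_sub, Polynomial.aeval_X, Polynomial.aeval_C,
    mul_apply_eq_comp, hv, map_zero] at h3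
  rw [← sub_eq_zero]
  simpa [Algebra.algebraMap_eq_smul_one] using h3

/-- A nonzero entire function of a normal operator only annihilates vectors in the span of the
eigenvectors. -/
lemma mem_eigenspan_of_cfc_apply_eq_zero {H : Type*} [NormedAddCommGroup H]
    [InnerProductSpace ℂ H] [CompleteSpace H] {Z : H →L[ℂ] H} [hZ : IsStarNormal Z]
    {f : ℂ → ℂ} (hf : Differentiable ℂ f) (hne : ∃ z, f z ≠ 0) {v : H} (hv : cfc f Z v = 0) :
    v ∈ eigenspan Z := by
  -- Infinitely many zeros in a compact set would accumulate, and the identity theorem would give `f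
  -- = 0`.
  have hfin : (spectrum ℂ Z ∩ {z | f z = 0}).Finite := by
    by_contra hinf
    obtain ⟨z₀, -, hz₀⟩ := Set.Infinite.exists_accPt_of_subset_isCompact hinf
      (spectrum.isCompact Z) Set.inter_subset_left
    have han : AnalyticOnNhd ℂ f Set.univ := fun z _ => hf.analyticAt z
    obtain ⟨z, hz⟩ := hne
    refine hz (han.eqOn_zero_of_preconnected_of_frequently_eq_zero isPreconnected_univ
      (Set.mem_univ z₀) ?_ (Set.mem_univ z))
    exact (accPt_iff_frequently_nhdsNE.mp hz₀).mono fun x hx => hx.2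
  refine mem_eigenspan_of_aeval_nodal hfin.toFinset ?_
  rw [← cfc_polynomial _ Z hZ]
  refine ContinuousLinearMap.cfc_apply_eq_zero_of_zeros_subset hf.continuous.continuousOn
    (Polynomial.continuous _).continuousOn (fun z hz h0 => ?_) hv
  exact Lagrange.eval_nodal_at_node (v := id) (hfin.mem_toFinset.mpr ⟨hz, h0⟩)

/-! ### The symmetry of a subspace and the unitary group of a co-diagonal exponent -/

section Geodesic

variable {H : Type*} [NormedAddCommGroup H] [InnerProductSpace ℂ H]

variable {K : Submodule ℂ H} [K.HasOrthogonalProjection]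

lemma IsCodiagonal.starProjection_mul {T : H →L[ℂ] H} (hT : IsCodiagonal K T) :
    K.starProjection * T = T * (1 - K.starProjection) := by
  ext x
  have h1 : K.starProjection (T (K.starProjection x)) = 0 :=
    (Submodule.starProjection_apply_eq_zero_iff K).mpr
      (hT.1 _ (Submodule.starProjection_apply_mem K x))
  have h2 : K.starProjection (T (x - K.starProjection x)) = T (x - K.starProjection x) :=
    Submodule.starProjection_eq_self_iff.mpr (hT.2 _ (Submodule.sub_starProjection_mem_orthogonal x))
  calc K.starProjection (T x)
      = K.starProjection (T (K.starProjection x)) +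
        K.starProjection (T (x - K.starProjection x)) := by rw [← map_add, ← map_add, add_sub_cancel]
    _ = T (x - K.starProjection x) := by rw [h1, h2, zero_add]

/-- The symmetry `2P - 1` of a closed subspace. -/
noncomputable def subspaceSymmetry (K : Submodule ℂ H) [K.HasOrthogonalProjection] : H →L[ℂ] H :=
  (2 : ℂ) • K.starProjection - 1

lemma starProjection_eq_subspaceSymmetry :
    K.starProjection = (1 / 2 : ℂ) • (1 + subspaceSymmetry K) := by
  rw [subspaceSymmetry]; module

lemma subspaceSymmetry_mul_self : subspaceSymmetry K * subspaceSymmetry K = 1 := by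
  have h : K.starProjection * K.starProjection = K.starProjection :=
    K.isIdempotentElem_starProjection
  simp only [subspaceSymmetry, mul_sub, sub_mul, mul_one, one_mul, smul_mul_smul_comm, h]
  module

lemma IsCodiagonal.subspaceSymmetry_mul {T : H →L[ℂ] H} (hT : IsCodiagonal K T) :
    subspaceSymmetry K * T = -(T * subspaceSymmetry K) := by
  simp only [subspaceSymmetry, sub_mul, mul_sub, smul_mul_assoc, hT.starProjection_mul, mul_one,
    one_mul, mul_smul_comm]
  module

variable [CompleteSpace H]

lemma expItZ_coe (Z : selfAdjoint (H →L[ℂ] H)) (t : ℝ) :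
    (expItZ Z t : H →L[ℂ] H) = NormedSpace.exp (Complex.I • (t • (Z : H →L[ℂ] H))) := rfl

lemma expItZ_eq_cfc (Z : selfAdjoint (H →L[ℂ] H)) (t : ℝ) :
    (expItZ Z t : H →L[ℂ] H) =
      cfc (fun z : ℂ => Complex.exp (Complex.I * t * z)) (Z : H →L[ℂ] H) := by
  have hZ : IsStarNormal (Z : H →L[ℂ] H) := Z.2.isStarNormal
  have h : (fun z : ℂ => Complex.exp (Complex.I * t * z)) =
      fun z => Complex.exp ((Complex.I * t) • z) := by
    ext z; rw [smul_eq_mul]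
  rw [h, cfc_comp_smul (Complex.I * (t : ℂ)) Complex.exp (Z : H →L[ℂ] H)
    Complex.continuous_exp.continuousOn,
    CFC.complex_exp_eq_normedSpace_exp (ha := ?_), expItZ_coe]
  · congr 1
    simp only [← smul_smul, Complex.coe_smul]
  · infer_instance

lemma expItZ_mul (Z : selfAdjoint (H →L[ℂ] H)) (a b : ℝ) :
    (expItZ Z a : H →L[ℂ] H) * expItZ Z b = expItZ Z (a + b) := by
  let +nondep : NormedAlgebra ℚ (H →L[ℂ] H) := .restrictScalars ℚ ℂ (H →L[ℂ] H)
  have h : Commute (Complex.I • (a • (Z : H →L[ℂ] H))) (Complex.I • (b • (Z : H →L[ℂ] H))) :=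
    ((((Commute.refl _).smul_left a).smul_right b).smul_left _).smul_right _
  simp only [expItZ_coe]
  rw [← NormedSpace.exp_add_of_commute h, ← smul_add, ← add_smul]

lemma expItZ_zero (Z : selfAdjoint (H →L[ℂ] H)) : (expItZ Z 0 : H →L[ℂ] H) = 1 := by
  rw [expItZ_coe, zero_smul, smul_zero, NormedSpace.exp_zero]

lemma expItZ_mul_neg (Z : selfAdjoint (H →L[ℂ] H)) (t : ℝ) :
    (expItZ Z t : H →L[ℂ] H) * expItZ Z (-t) = 1 := by
  rw [expItZ_mul, add_neg_cancel, expItZ_zero]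

lemma expItZ_neg_mul (Z : selfAdjoint (H →L[ℂ] H)) (t : ℝ) :
    (expItZ Z (-t) : H →L[ℂ] H) * expItZ Z t = 1 := by
  rw [expItZ_mul, neg_add_cancel, expItZ_zero]

lemma star_expItZ (Z : selfAdjoint (H →L[ℂ] H)) (t : ℝ) :
    star (expItZ Z t : H →L[ℂ] H) = expItZ Z (-t) := by
  have h1 : star (expItZ Z t : H →L[ℂ] H) * expItZ Z t = 1 := Unitary.coe_star_mul_self _
  calc star (expItZ Z t : H →L[ℂ] H)
      = star (expItZ Z t : H →L[ℂ] H) * (expItZ Z t * expItZ Z (-t)) := by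
        rw [expItZ_mul_neg, mul_one]
    _ = expItZ Z (-t) := by rw [← mul_assoc, h1, one_mul]

lemma commute_expItZ (Z : selfAdjoint (H →L[ℂ] H)) (t : ℝ) :
    Commute (Z : H →L[ℂ] H) (expItZ Z t : H →L[ℂ] H) := by
  rw [expItZ_eq_cfc]
  have h := cfc_commute_cfc (fun z => z) (fun z : ℂ => Complex.exp (Complex.I * t * z))
    (Z : H →L[ℂ] H)
  rwa [cfc_id' ℂ (Z : H →L[ℂ] H) (ha := Z.2.isStarNormal)] at h

lemma expItZ_apply_of_eigenvector {Z : selfAdjoint (H →L[ℂ] H)} {v : H} {μ : ℂ}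
    (h : (Z : H →L[ℂ] H) v = μ • v) (t : ℝ) :
    (expItZ Z t : H →L[ℂ] H) v = Complex.exp (Complex.I * t * μ) • v := by
  have hZ : IsStarNormal (Z : H →L[ℂ] H) := Z.2.isStarNormal
  have h1 : cfc (fun z : ℂ => z - μ) (Z : H →L[ℂ] H) v = 0 := by
    rw [cfc_sub (fun z => z) (fun _ => μ) (Z : H →L[ℂ] H), cfc_id' ℂ (Z : H →L[ℂ] H),
      cfc_const μ (Z : H →L[ℂ] H)]
    simp [h, Algebra.algebraMap_eq_smul_one]
  have h2 := ContinuousLinearMap.cfc_apply_eq_zero_of_zeros_subset (by fun_prop)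
    (g := fun z => Complex.exp (Complex.I * t * z) - Complex.exp (Complex.I * t * μ))
    (by fun_prop) (fun z _ hz => by rw [sub_eq_zero.mp hz, sub_self]) h1
  rw [cfc_sub (fun z => Complex.exp (Complex.I * t * z)) (fun _ => Complex.exp (Complex.I * t * μ))
    (Z : H →L[ℂ] H) (by fun_prop) (by fun_prop), cfc_const _ (Z : H →L[ℂ] H), ← expItZ_eq_cfc] at h2
  rw [← sub_eq_zero]
  simpa [Algebra.algebraMap_eq_smul_one] using h2

/-- A nontrivial trigonometric polynomial in `Z` only annihilates vectors in the span of the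
eigenvectors of `Z`. -/
lemma mem_eigenspan_of_trigonometric {Z : selfAdjoint (H →L[ℂ] H)} {t : ℝ} (ht : t ≠ 0)
    {a b : ℂ} {v : H}
    (hv : (expItZ Z t : H →L[ℂ] H) v + a • (expItZ Z (-t) : H →L[ℂ] H) v + b • v = 0) :
    v ∈ eigenspan (Z : H →L[ℂ] H) := by
  have hZ : IsStarNormal (Z : H →L[ℂ] H) := Z.2.isStarNormal
  refine mem_eigenspan_of_cfc_apply_eq_zero (f := fun z =>
    Complex.exp (Complex.I * t * z) + a * Complex.exp (Complex.I * (-t : ℝ) * z) + b)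
    (by fun_prop) ?_ ?_
  -- With `w = e^{itz}`, the three points give `w = 1, -1, i`. The first two force `b = 0` and `a =
  -- -1`; the third then has value `2i`.
  · by_contra! h
    have ht' : (t : ℂ) ≠ 0 := by exact_mod_cast ht
    have h0 := h 0
    have h1 := h (Real.pi / t)
    have h2 := h (Real.pi / 2 / t)
    have e1 : Complex.I * t * (Real.pi / t) = Real.pi * Complex.I := by field_simp
    have e2 : Complex.I * (-t : ℝ) * (Real.pi / t) = -(Real.pi * Complex.I) := by
      push_cast; field_simp
    have e3 : Complex.I * t * (Real.pi / 2 / t) = Real.pi / 2 * Complex.I := by field_simp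
    have e4 : Complex.I * (-t : ℝ) * (Real.pi / 2 / t) = -(Real.pi / 2 * Complex.I) := by
      push_cast; field_simp
    rw [e1, e2, Complex.exp_neg, Complex.exp_pi_mul_I] at h1
    rw [e3, e4, Complex.exp_neg, Complex.exp_pi_div_two_mul_I, Complex.inv_I] at h2
    simp only [mul_zero, Complex.exp_zero] at h0
    norm_num at h1
    have hb : b = 0 := by linear_combination (h0 + h1) / 2
    have ha : a = -1 := by linear_combination h0 - hb
    rw [ha, hb] at h2
    ring_nf at h2
    simp at h2
  · rw [cfc_add (Z : H →L[ℂ] H) (fun z => Complex.exp (Complex.I * t * z) +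
        a * Complex.exp (Complex.I * (-t : ℝ) * z)) (fun _ => b)
        (by fun_prop) (by fun_prop),
      cfc_add (Z : H →L[ℂ] H) (fun z => Complex.exp (Complex.I * t * z))
        (fun z => a * Complex.exp (Complex.I * (-t : ℝ) * z))
        (by fun_prop) (by fun_prop), cfc_const b (Z : H →L[ℂ] H),
      cfc_const_mul a (fun z => Complex.exp (Complex.I * (-t : ℝ) * z)) (Z : H →L[ℂ] H)
        (by fun_prop), ← expItZ_eq_cfc, ← expItZ_eq_cfc]
    simpa only [add_apply, smul_apply, Algebra.algebraMap_eq_smul_one,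
      one_apply_eq_self] using hv

lemma IsCodiagonal.subspaceSymmetry_mul_expItZ {Z : selfAdjoint (H →L[ℂ] H)}
    (hZ : IsCodiagonal K (Z : H →L[ℂ] H)) (t : ℝ) :
    subspaceSymmetry K * (expItZ Z t : H →L[ℂ] H) = expItZ Z (-t) * subspaceSymmetry K := by
  let J : (H →L[ℂ] H)ˣ := ⟨subspaceSymmetry K, subspaceSymmetry K, subspaceSymmetry_mul_self,
    subspaceSymmetry_mul_self⟩
  let +nondep : NormedAlgebra ℚ (H →L[ℂ] H) := .restrictScalars ℚ ℂ (H →L[ℂ] H)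
  have h := NormedSpace.exp_units_conj J (Complex.I • (t • (Z : H →L[ℂ] H)))
  have h2 : (J : H →L[ℂ] H) * (Complex.I • (t • (Z : H →L[ℂ] H))) * (↑J⁻¹ : H →L[ℂ] H) =
      Complex.I • ((-t) • (Z : H →L[ℂ] H)) := by
    change subspaceSymmetry K * _ * subspaceSymmetry K = _
    rw [mul_smul_comm, mul_smul_comm, hZ.subspaceSymmetry_mul, smul_mul_assoc, smul_mul_assoc,
      neg_mul, mul_assoc, subspaceSymmetry_mul_self, mul_one, smul_neg, neg_smul]
  rw [h2] at h
  have h3 : (expItZ Z (-t) : H →L[ℂ] H) =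
      subspaceSymmetry K * (expItZ Z t : H →L[ℂ] H) * subspaceSymmetry K := h
  rw [h3, mul_assoc, subspaceSymmetry_mul_self, mul_one]

lemma starProjection_grassmannGeodesic (Z : selfAdjoint (H →L[ℂ] H)) (t : ℝ) :
    (grassmannGeodesic K Z t).starProjection =
      (expItZ Z t : H →L[ℂ] H) * K.starProjection * expItZ Z (-t) := by
  ext x
  rw [Submodule.starProjection_map_apply, ← star_expItZ]
  rfl

/-- Moving `J` past the exponential gives `P_{δ(t)} = (1 + e^{2itZ} J) / 2`, so the commutator is a
quarter of `[J, e^{2itZ} J]`. -/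
lemma IsCodiagonal.geodesicCommutator_eq {Z : selfAdjoint (H →L[ℂ] H)}
    (hZ : IsCodiagonal K (Z : H →L[ℂ] H)) (t : ℝ) :
    geodesicCommutator K Z t =
      (1 / 4 : ℂ) • ((expItZ Z (-(2 * t)) : H →L[ℂ] H) - expItZ Z (2 * t)) := by
  have h1 : (grassmannGeodesic K Z t).starProjection =
      (1 / 2 : ℂ) • (1 + (expItZ Z (2 * t) : H →L[ℂ] H) * subspaceSymmetry K) := by
    have h := hZ.subspaceSymmetry_mul_expItZ (-t)
    rw [neg_neg] at h
    rw [starProjection_grassmannGeodesic, starProjection_eq_subspaceSymmetry, mul_smul_comm,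
      smul_mul_assoc, mul_add, add_mul, mul_one, expItZ_mul_neg, mul_assoc, h, ← mul_assoc,
      expItZ_mul, ← two_mul]
  have h2 := hZ.subspaceSymmetry_mul_expItZ (2 * t)
  have h3 : subspaceSymmetry K * ((expItZ Z (2 * t) : H →L[ℂ] H) * subspaceSymmetry K) =
      expItZ Z (-(2 * t)) := by
    rw [← mul_assoc, h2, mul_assoc, subspaceSymmetry_mul_self, mul_one]
  rw [geodesicCommutator, Ring.lie_def, h1, starProjection_eq_subspaceSymmetry (K := K)]
  simp only [smul_mul_smul_comm, add_mul, mul_add, one_mul, mul_one, h3, mul_assoc,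
    subspaceSymmetry_mul_self]
  module

lemma IsCodiagonal.commute_starProjection {Z : selfAdjoint (H →L[ℂ] H)}
    (hZ : IsCodiagonal K (Z : H →L[ℂ] H)) (t : ℝ) :
    Commute K.starProjection ((expItZ Z t : H →L[ℂ] H) + expItZ Z (-t)) := by
  have h := hZ.subspaceSymmetry_mul_expItZ (-t)
  rw [neg_neg] at h
  rw [starProjection_eq_subspaceSymmetry]
  refine (((Commute.one_left _).add_left ?_).smul_left _)
  rw [Commute, SemiconjBy, mul_add, h, hZ.subspaceSymmetry_mul_expItZ, add_mul, add_comm]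

/-- Since `J x = x` on `K`, `J e^{itZ} x = e^{-itZ} x`; apply `P = (1 + J) / 2`. -/
lemma IsCodiagonal.starProjection_expItZ_apply {Z : selfAdjoint (H →L[ℂ] H)}
    (hZ : IsCodiagonal K (Z : H →L[ℂ] H)) (t : ℝ) {x : H} (hx : x ∈ K) :
    K.starProjection ((expItZ Z t : H →L[ℂ] H) x) =
      (1 / 2 : ℂ) • ((expItZ Z t : H →L[ℂ] H) x + (expItZ Z (-t) : H →L[ℂ] H) x) := by
  have h1 : subspaceSymmetry K x = x := by
    have := Submodule.starProjection_eq_self_iff.mpr hx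
    simp only [subspaceSymmetry, sub_apply, smul_apply, one_apply_eq_self, this]
    module
  have h2 : subspaceSymmetry K ((expItZ Z t : H →L[ℂ] H) x) =
      (expItZ Z (-t) : H →L[ℂ] H) (subspaceSymmetry K x) :=
    DFunLike.congr_fun (hZ.subspaceSymmetry_mul_expItZ t) x
  rw [h1] at h2
  rw [starProjection_eq_subspaceSymmetry, smul_apply, add_apply, one_apply_eq_self, h2]

end Geodesic

/-! ### Diagonalizability, Schmidt decompositions and compressions -/

section Diagonalization

variable {E : Type u} [NormedAddCommGroup E] [InnerProductSpace ℂ E]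

lemma inner_eq_zero_of_mem_orthogonal_eigenspan {T : E →L[ℂ] E} {v x : E} {μ : ℂ}
    (hx : x ∈ (eigenspan T)ᗮ) (hv : T v = μ • v) : inner ℂ v x = 0 :=
  Submodule.inner_right_of_mem_orthogonal (mem_eigenspan hv) hx

lemma mem_orthogonal_eigenspan {T : E →L[ℂ] E} {x : E}
    (h : ∀ (v : E) (μ : ℂ), T v = μ • v → inner ℂ v x = 0) : x ∈ (eigenspan T)ᗮ := by
  have h1 : eigenspan T ≤ (Submodule.span ℂ {x})ᗮ := eigenspan_le fun v μ hv =>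
    Submodule.mem_orthogonal_singleton_iff_inner_left.mpr (h v μ hv)
  exact fun v hv => Submodule.mem_orthogonal_singleton_iff_inner_left.mp (h1 hv)

/-- Eigenspaces of a symmetric operator are mutually orthogonal, so Hilbert bases of them combine
into an orthonormal system, complete by totality. -/
lemma isDiagonalizable_of_isSymmetric [CompleteSpace E] {T : E →L[ℂ] E}
    (hT : (T : E →ₗ[ℂ] E).IsSymmetric) (h : (eigenspan T)ᗮ = ⊥) : IsDiagonalizable T := by
  have hc : ∀ μ : ℂ, CompleteSpace (Module.End.eigenspace (T : E →ₗ[ℂ] E) μ) := fun μ => by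
    have h1 : IsClosed (Module.End.eigenspace (T : E →ₗ[ℂ] E) μ : Set E) := by
      have h2 : (Module.End.eigenspace (T : E →ₗ[ℂ] E) μ : Set E) = {x | T x = μ • x} := by
        ext x; simp
      rw [h2]
      exact isClosed_eq T.continuous (continuous_const_smul μ)
    exact h1.completeSpace_coe
  choose w b hb using fun μ : ℂ =>
    exists_hilbertBasis ℂ (Module.End.eigenspace (T : E →ₗ[ℂ] E) μ)
  have ho := hT.orthogonalFamily_eigenspaces.orthonormal_sigma_orthonormal
    (v_family := fun μ => b μ) fun μ => (b μ).orthonormal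
  refine ⟨Σ μ : ℂ, w μ, HilbertBasis.mkOfOrthogonalEqBot ho ?_, fun ⟨μ, i⟩ => ⟨μ, ?_⟩⟩
  · rw [eq_bot_iff, ← h]
    refine fun x hx => mem_orthogonal_eigenspan fun v μ hv => ?_
    have hv' : v ∈ Module.End.eigenspace (T : E →ₗ[ℂ] E) μ := Module.End.mem_eigenspace_iff.mpr hv
    have h2 := ((b μ).hasSum_repr ⟨v, hv'⟩).mapL
      (Module.End.eigenspace (T : E →ₗ[ℂ] E) μ).subtypeL
    have h3 : v ∈ (Submodule.span ℂ {x})ᗮ := by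
      refine (Submodule.isClosed_orthogonal _).mem_of_tendsto h2 (Filter.Eventually.of_forall
        fun s => Submodule.sum_mem _ fun i _ => ?_)
      rw [map_smul]
      refine Submodule.smul_mem _ _ (Submodule.mem_orthogonal_singleton_iff_inner_left.mpr ?_)
      exact hx _ (Submodule.subset_span ⟨⟨μ, i⟩, rfl⟩)
    exact Submodule.mem_orthogonal_singleton_iff_inner_left.mp h3
  · rw [HilbertBasis.coe_mkOfOrthogonalEqBot]
    exact Module.End.mem_eigenspace_iff.mp (b μ i).2

lemma IsDiagonalizable.orthogonal_eigenspan {T : E →L[ℂ] E} (hT : IsDiagonalizable T) :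
    (eigenspan T)ᗮ = ⊥ := by
  obtain ⟨ι, b, hb⟩ := hT
  rw [eq_bot_iff]
  intro x hx
  have h : ∀ i, b.repr x i = 0 := fun i => by
    obtain ⟨μ, hμ⟩ := hb i
    rw [b.repr_apply_apply]
    exact inner_eq_zero_of_mem_orthogonal_eigenspan hx hμ
  have h2 := b.hasSum_repr x
  simp only [h, zero_smul] at h2
  exact h2.unique hasSum_zero

/-- Zero eigenvalues are dropped; the phases of the others are absorbed into the left system. -/
lemma IsDiagonalizable.isSchmidtDecomposable {T : E →L[ℂ] E} (hT : IsDiagonalizable T) :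
    IsSchmidtDecomposable T := by
  obtain ⟨ι, b, hb⟩ := hT
  choose μ hμ using hb
  have hpos : ∀ i : {i // μ i ≠ 0}, 0 < ‖μ i‖ := fun i => norm_pos_iff.mpr i.2
  have hg : Orthonormal ℂ fun i : {i // μ i ≠ 0} => b i :=
    b.orthonormal.comp _ Subtype.val_injective
  refine ⟨{i // μ i ≠ 0}, fun i => (μ i / (‖μ i‖ : ℂ)) • b i, fun i => b i, fun i => ‖μ i‖,
    ⟨fun i => ?_, fun i j hij => ?_⟩, hg, hpos, fun h => ?_⟩
  · rw [norm_smul, hg.1 i, mul_one, norm_div, Complex.norm_real, norm_norm,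
      div_self (hpos i).ne']
  · simp only [inner_smul_left, inner_smul_right]
    rw [hg.2 hij]
    simp
  · have h1 := (b.hasSum_repr h).mapL T
    have h2 : (fun i => T (b.repr h i • b i)) = fun i => (μ i * inner ℂ (b i) h) • b i := by
      ext i
      rw [map_smul, hμ, smul_smul, b.repr_apply_apply, mul_comm]
    rw [h2, ← hasSum_subtype_iff_of_support_subset (s := {i | μ i ≠ 0})] at h1
    · have h3 : ∀ i : {i // μ i ≠ 0}, ((‖μ i‖ : ℂ) * inner ℂ (b i) h) •
          ((μ i / (‖μ i‖ : ℂ)) • b i) = (μ i * inner ℂ (b i) h) • b i := fun i => by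
        have h4 : (‖μ i‖ : ℂ) ≠ 0 := by exact_mod_cast (hpos i).ne'
        rw [smul_smul]
        congr 1
        field_simp
      simp only [h3]
      exact h1
    · intro i hi h0
      exact hi (by simp [h0])

/-- By symmetry `T gᵢ = sᵢ fᵢ` and `T fᵢ = sᵢ gᵢ`, so `gᵢ` is an eigenvector of `T²`, though not
necessarily of `T`. A vector orthogonal to all `gᵢ` lies in the kernel. -/
lemma IsSchmidtDecomposable.orthogonal_eigenspan_sq {T : E →L[ℂ] E}
    (hT : IsSchmidtDecomposable T) (hs : (T : E →ₗ[ℂ] E).IsSymmetric) :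
    (eigenspan (T * T))ᗮ = ⊥ := by
  obtain ⟨ι, f, g, s, hf, hg, -, hsum⟩ := hT
  have hTg : ∀ i, T (g i) = (s i : ℂ) • f i := fun i => by
    refine (hsum (g i)).unique ?_
    convert hasSum_single (f := fun j => ((s j : ℂ) * inner ℂ (g j) (g i)) • f j) i ?_ using 1
    · simp [inner_self_eq_norm_sq_to_K, hg.1 i]
    · intro j hj
      simp [hg.2 hj]
  have hTf : ∀ i, T (f i) = (s i : ℂ) • g i := fun i => by
    refine ext_inner_left ℂ fun h => ?_
    have h1 : inner ℂ h (T (f i)) = inner ℂ (T h) (f i) := (hs h (f i)).symm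
    have h2 := (innerSL ℂ (f i)).hasSum (hsum h)
    have h3 : inner ℂ (f i) (T h) = (s i : ℂ) * inner ℂ (g i) h := by
      refine h2.unique ?_
      have h4 : (innerSL ℂ (f i)) (((s i : ℂ) * inner ℂ (g i) h) • f i) =
          (s i : ℂ) * inner ℂ (g i) h := by
        simp [inner_self_eq_norm_sq_to_K, hf.1 i]
      rw [← h4]
      refine hasSum_single i fun j hj => ?_
      simp [hf.2 hj.symm]
    rw [h1, ← inner_conj_symm, h3, inner_smul_right, map_mul, inner_conj_symm, Complex.conj_ofReal]
  rw [eq_bot_iff]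
  intro x hx
  have hx0 : T x = 0 := by
    refine (hsum x).unique ?_
    have : ∀ i, inner ℂ (g i) x = 0 := fun i =>
      inner_eq_zero_of_mem_orthogonal_eigenspan (μ := s i * s i) hx (by
        rw [mul_apply_eq_comp, hTg, map_smul, hTf, smul_smul])
    simp only [this, mul_zero, zero_smul]
    exact hasSum_zero
  refine inner_self_eq_zero (𝕜 := ℂ).mp
    (inner_eq_zero_of_mem_orthogonal_eigenspan (μ := 0) hx ?_)
  rw [mul_apply_eq_comp, hx0, map_zero, zero_smul]

variable {K : Submodule ℂ E} [K.HasOrthogonalProjection]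

lemma compression_coe_apply (T : E →L[ℂ] E) (x : K) :
    (compression K T x : E) = K.starProjection (T x) := rfl

lemma isSymmetric_compression {T : E →L[ℂ] E} (hT : (T : E →ₗ[ℂ] E).IsSymmetric) :
    (compression K T : K →ₗ[ℂ] K).IsSymmetric := by
  intro x y
  have h := hT x y
  change inner ℂ (compression K T x : E) (y : E) = inner ℂ (x : E) (compression K T y : E)
  rw [compression_coe_apply, compression_coe_apply, Submodule.inner_starProjection_left_eq_right,
    ← Submodule.inner_starProjection_left_eq_right K (x : E),
    Submodule.starProjection_eq_self_iff.mpr x.2, Submodule.starProjection_eq_self_iff.mpr y.2]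
  exact h

/-- A projection commuting with `T` sends eigenvectors of `T` to eigenvectors of the compression, or
to zero. -/
lemma orthogonal_eigenspan_compression {T : E →L[ℂ] E} (hT : Commute K.starProjection T)
    (h : (eigenspan T)ᗮ = ⊥) : (eigenspan (compression K T))ᗮ = ⊥ := by
  rw [eq_bot_iff]
  intro x hx
  have hx' : (x : E) ∈ (eigenspan T)ᗮ := mem_orthogonal_eigenspan fun v μ hv => by
    have h1 : compression K T (K.orthogonalProjectionOnto v) =
        μ • K.orthogonalProjectionOnto v := by
      ext
      have h2 : K.starProjection (T v) = T (K.starProjection v) := DFunLike.congr_fun hT.eq v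
      change K.starProjection (T (K.starProjection v)) = μ • K.starProjection v
      rw [← h2, hv, map_smul, map_smul]
      congr 1
      exact Submodule.starProjection_eq_self_iff.mpr (Submodule.starProjection_apply_mem K v)
    have h2 : inner ℂ (K.orthogonalProjectionOnto v) x = 0 :=
      inner_eq_zero_of_mem_orthogonal_eigenspan hx h1
    rwa [Submodule.coe_inner, ← Submodule.starProjection_apply,
      Submodule.inner_starProjection_left_eq_right,
      Submodule.starProjection_eq_self_iff.mpr x.2] at h2
  rw [h, Submodule.mem_bot] at hx'
  exact (Submodule.mem_bot ℂ).mpr (Subtype.ext hx')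

lemma commute_starProjection_of_isSymmetric {T : E →L[ℂ] E} (hT : (T : E →ₗ[ℂ] E).IsSymmetric)
    (hK : ∀ x ∈ K, T x ∈ K) : Commute K.starProjection T := by
  have hK' : ∀ x ∈ Kᗮ, T x ∈ Kᗮ := fun x hx y hy => by
    have h := hT y x
    exact h.symm.trans (hx _ (hK y hy))
  ext x
  change K.starProjection (T x) = T (K.starProjection x)
  have h1 := Submodule.starProjection_eq_self_iff.mpr (hK _ (Submodule.starProjection_apply_mem K x))
  have h2 := (Submodule.starProjection_apply_eq_zero_iff K).mpr
    (hK' _ (Submodule.sub_starProjection_mem_orthogonal (K := K) x))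
  rw [map_sub, map_sub, h1, sub_eq_zero] at h2
  exact h2

end Diagonalization

/-! ### The generic part and totality of eigenvectors -/

section GenericPart

variable {H : Type u} [NormedAddCommGroup H] [InnerProductSpace ℂ H] [CompleteSpace H]
  {K : Submodule ℂ H} {Z : selfAdjoint (H →L[ℂ] H)}

lemma selfAdjoint.isSymmetric (Z : selfAdjoint (H →L[ℂ] H)) :
    ((Z : H →L[ℂ] H) : H →ₗ[ℂ] H).IsSymmetric :=
  ContinuousLinearMap.isSelfAdjoint_iff_isSymmetric.mp Z.2

lemma inner_expItZ_left (t : ℝ) (x y : H) :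
    inner ℂ ((expItZ Z t : H →L[ℂ] H) x) y = inner ℂ x ((expItZ Z (-t) : H →L[ℂ] H) y) := by
  rw [← star_expItZ, ContinuousLinearMap.star_eq_adjoint, ContinuousLinearMap.adjoint_inner_right]

lemma expItZ_apply_expItZ_neg (t : ℝ) (x : H) :
    (expItZ Z t : H →L[ℂ] H) ((expItZ Z (-t) : H →L[ℂ] H) x) = x :=
  DFunLike.congr_fun (expItZ_mul_neg Z t) x

lemma expItZ_neg_apply_expItZ (t : ℝ) (x : H) :
    (expItZ Z (-t) : H →L[ℂ] H) ((expItZ Z t : H →L[ℂ] H) x) = x :=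
  DFunLike.congr_fun (expItZ_neg_mul Z t) x

lemma apply_expItZ_comm (t : ℝ) (x : H) : (Z : H →L[ℂ] H) ((expItZ Z t : H →L[ℂ] H) x) =
    (expItZ Z t : H →L[ℂ] H) ((Z : H →L[ℂ] H) x) :=
  DFunLike.congr_fun (commute_expItZ Z t).eq x

lemma mem_grassmannGeodesic {t : ℝ} {y : H} :
    y ∈ grassmannGeodesic K Z t ↔ ∃ x ∈ K, (expItZ Z t : H →L[ℂ] H) x = y := Iff.rfl

lemma IsCodiagonal.isCodiagonal_grassmannGeodesic (hZ : IsCodiagonal K (Z : H →L[ℂ] H)) (t : ℝ) :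
    IsCodiagonal (grassmannGeodesic K Z t) (Z : H →L[ℂ] H) := by
  constructor
  · rintro y hy z hz
    obtain ⟨x, hx, rfl⟩ := mem_grassmannGeodesic.mp hy
    obtain ⟨w, hw, rfl⟩ := mem_grassmannGeodesic.mp hz
    rw [apply_expItZ_comm, inner_expItZ_left, expItZ_neg_apply_expItZ]
    exact hZ.1 x hx w hw
  · intro y hy
    have h : (expItZ Z (-t) : H →L[ℂ] H) y ∈ Kᗮ := fun x hx => by
      rw [← inner_expItZ_left]
      exact hy _ (mem_grassmannGeodesic.mpr ⟨x, hx, rfl⟩)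
    refine mem_grassmannGeodesic.mpr ⟨_, hZ.2 _ h, ?_⟩
    rw [← apply_expItZ_comm, expItZ_apply_expItZ_neg]

/-- `Z` maps `K ⊓ L` and `Kᗮ ⊓ Lᗮ` into each other, and likewise `K ⊓ Lᗮ` and `Kᗮ ⊓ L`. Their sum is
invariant, hence so is its orthogonal complement. -/
lemma IsCodiagonal.apply_mem_halmosGenericPart {L : Submodule ℂ H}
    (hK : IsCodiagonal K (Z : H →L[ℂ] H)) (hL : IsCodiagonal L (Z : H →L[ℂ] H)) {x : H}
    (hx : x ∈ halmosGenericPart K L) : (Z : H →L[ℂ] H) x ∈ halmosGenericPart K L := by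
  have hM : (K ⊓ L) ⊔ (Kᗮ ⊓ Lᗮ) ⊔ (K ⊓ Lᗮ) ⊔ (Kᗮ ⊓ L) ≤
      ((K ⊓ L) ⊔ (Kᗮ ⊓ Lᗮ) ⊔ (K ⊓ Lᗮ) ⊔ (Kᗮ ⊓ L)).comap
        ((Z : H →L[ℂ] H) : H →ₗ[ℂ] H) := by
    refine sup_le (sup_le (sup_le ?_ ?_) ?_) ?_ <;> rintro y ⟨hy1, hy2⟩
    · exact Submodule.mem_sup_left (Submodule.mem_sup_left (Submodule.mem_sup_right
        ⟨hK.1 y hy1, hL.1 y hy2⟩))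
    · exact Submodule.mem_sup_left (Submodule.mem_sup_left (Submodule.mem_sup_left
        ⟨hK.2 y hy1, hL.2 y hy2⟩))
    · exact Submodule.mem_sup_right ⟨hK.1 y hy1, hL.2 y hy2⟩
    · exact Submodule.mem_sup_left (Submodule.mem_sup_right ⟨hK.2 y hy1, hL.1 y hy2⟩)
  intro y hy
  exact (selfAdjoint.isSymmetric Z y x).symm.trans (hx _ (hM hy))

lemma IsCodiagonal.isDiagonalizable_exponentGenericPart
    (hZ : IsCodiagonal K (Z : H →L[ℂ] H)) (s : ℝ)
    (h : (eigenspan (Z : H →L[ℂ] H))ᗮ = ⊥) :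
    IsDiagonalizable (exponentGenericPart K Z s) := by
  have : CompleteSpace (halmosGenericPart K (grassmannGeodesic K Z s)) :=
    (Submodule.isClosed_orthogonal _).completeSpace_coe
  exact isDiagonalizable_of_isSymmetric (isSymmetric_compression (selfAdjoint.isSymmetric Z))
    (orthogonal_eigenspan_compression (commute_starProjection_of_isSymmetric
      (selfAdjoint.isSymmetric Z) fun _ hx =>
        hZ.apply_mem_halmosGenericPart (hZ.isCodiagonal_grassmannGeodesic s) hx) h)

variable [K.HasOrthogonalProjection]

lemma IsCodiagonal.mem_eigenspan_of_geodesicCommutator_apply_eq_zero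
    (hZ : IsCodiagonal K (Z : H →L[ℂ] H)) {t : ℝ} (ht : t ≠ 0) {x : H}
    (hx : geodesicCommutator K Z t x = 0) : x ∈ eigenspan (Z : H →L[ℂ] H) := by
  rw [hZ.geodesicCommutator_eq, smul_apply, sub_apply, smul_eq_zero_iff_right (by norm_num)] at hx
  refine mem_eigenspan_of_trigonometric (t := 2 * t) (a := -1) (b := 0) (by positivity) ?_
  rw [← neg_eq_zero.mpr hx]
  module

/-- Both projections act on `x` as the scalar 0 or 1. -/
lemma geodesicCommutator_apply_eq_zero {t : ℝ} {x : H} (h1 : x ∈ K ∨ x ∈ Kᗮ)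
    (h2 : x ∈ grassmannGeodesic K Z t ∨ x ∈ (grassmannGeodesic K Z t)ᗮ) :
    geodesicCommutator K Z t x = 0 := by
  rw [geodesicCommutator, Ring.lie_def]
  change K.starProjection ((grassmannGeodesic K Z t).starProjection x) -
    (grassmannGeodesic K Z t).starProjection (K.starProjection x) = 0
  have e1 : K.starProjection x = x ∨ K.starProjection x = 0 :=
    h1.imp Submodule.starProjection_eq_self_iff.mpr
      (Submodule.starProjection_apply_eq_zero_iff K).mpr
  have e2 : (grassmannGeodesic K Z t).starProjection x = x ∨
      (grassmannGeodesic K Z t).starProjection x = 0 :=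
    h2.imp Submodule.starProjection_eq_self_iff.mpr
      (Submodule.starProjection_apply_eq_zero_iff _).mpr
  rcases e1 with e1 | e1 <;> rcases e2 with e2 | e2 <;> simp [e1, e2]

/-- A co-diagonal exponent whose generic part is diagonalizable has a total set of eigenvectors. -/
lemma IsCodiagonal.orthogonal_eigenspan_of_exponentGenericPart
    (hZ : IsCodiagonal K (Z : H →L[ℂ] H)) {s : ℝ} (hs : s ≠ 0)
    (h : IsDiagonalizable (exponentGenericPart K Z s)) :
    (eigenspan (Z : H →L[ℂ] H))ᗮ = ⊥ := by
  have hinv := fun x =>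
    hZ.apply_mem_halmosGenericPart (hZ.isCodiagonal_grassmannGeodesic s) (x := x)
  -- The commutator kills the four non-generic pieces, so they lie in `eigenspan Z`; here `s ≠ 0` is
  -- needed.
  have hM : (eigenspan (Z : H →L[ℂ] H))ᗮ ≤ halmosGenericPart K (grassmannGeodesic K Z s) := by
    refine Submodule.orthogonal_le ?_
    refine sup_le (sup_le (sup_le ?_ ?_) ?_) ?_ <;> rintro y ⟨hy1, hy2⟩ <;>
      refine hZ.mem_eigenspan_of_geodesicCommutator_apply_eq_zero hs
        (geodesicCommutator_apply_eq_zero ?_ ?_)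
    exacts [.inl hy1, .inl hy2, .inr hy1, .inr hy2, .inl hy1, .inr hy2, .inr hy1, .inl hy2]
  have hG := h.orthogonal_eigenspan
  rw [eq_bot_iff] at hG ⊢
  intro x hx
  have h1 : (⟨x, hM hx⟩ : halmosGenericPart K (grassmannGeodesic K Z s)) ∈
      (eigenspan (exponentGenericPart K Z s))ᗮ := mem_orthogonal_eigenspan fun v μ hv => by
    refine inner_eq_zero_of_mem_orthogonal_eigenspan (μ := μ) (v := (v : H)) hx ?_
    have h2 := congrArg Subtype.val hv
    have h3 : (exponentGenericPart K Z s v : H) = (Z : H →L[ℂ] H) v :=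
      Submodule.starProjection_eq_self_iff.mpr (hinv _ v.2)
    rw [h3] at h2
    exact h2
  exact (Submodule.mem_bot ℂ).mpr (congrArg Subtype.val ((Submodule.mem_bot ℂ).mp (hG h1)))

/-- This replaces the unitary by the self-adjoint `cos(tZ)`, which moreover commutes with the
projection. -/
lemma IsCodiagonal.compression_expItZ (hZ : IsCodiagonal K (Z : H →L[ℂ] H)) (t : ℝ) :
    compression K (expItZ Z t : H →L[ℂ] H) =
      compression K ((1 / 2 : ℂ) • ((expItZ Z t : H →L[ℂ] H) + expItZ Z (-t))) := by
  ext x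
  have h := hZ.starProjection_expItZ_apply t x.2
  have h' := hZ.starProjection_expItZ_apply (-t) x.2
  rw [neg_neg] at h'
  rw [compression_coe_apply, compression_coe_apply, smul_apply, add_apply, map_smul, map_add,
    h, h']
  module

lemma isSymmetric_cos_expItZ (t : ℝ) :
    (((1 / 2 : ℂ) • ((expItZ Z t : H →L[ℂ] H) + expItZ Z (-t)) : H →L[ℂ] H) :
      H →ₗ[ℂ] H).IsSymmetric := by
  refine ContinuousLinearMap.isSelfAdjoint_iff_isSymmetric.mp ?_
  rw [IsSelfAdjoint, star_smul, star_add, star_expItZ, star_expItZ, neg_neg, add_comm]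
  congr 1
  simp

lemma IsCodiagonal.expItZ_mem_Sd (hZ : IsCodiagonal K (Z : H →L[ℂ] H))
    (h : (eigenspan (Z : H →L[ℂ] H))ᗮ = ⊥) [CompleteSpace K] (t : ℝ) : expItZ Z t ∈ Sd K := by
  change IsSchmidtDecomposable (compression K (expItZ Z t : H →L[ℂ] H))
  rw [hZ.compression_expItZ]
  refine (isDiagonalizable_of_isSymmetric (isSymmetric_compression (isSymmetric_cos_expItZ t))
    (orthogonal_eigenspan_compression ((hZ.commute_starProjection t).smul_right _)
      ?_)).isSchmidtDecomposable
  rw [eq_bot_iff, ← h]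
  refine Submodule.orthogonal_le (eigenspan_le fun v μ hv => mem_eigenspan (μ := (1 / 2 : ℂ) *
    (Complex.exp (Complex.I * t * μ) + Complex.exp (Complex.I * (-t : ℝ) * μ))) ?_)
  rw [smul_apply, add_apply, expItZ_apply_of_eigenvector hv, expItZ_apply_of_eigenvector hv]
  module

lemma IsCodiagonal.orthogonal_eigenspan_of_expItZ_mem_Sd (hZ : IsCodiagonal K (Z : H →L[ℂ] H))
    {t : ℝ} (ht : t ≠ 0) (h : expItZ Z t ∈ Sd K) : (eigenspan (Z : H →L[ℂ] H))ᗮ = ⊥ := by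
  have hS : IsSchmidtDecomposable (compression K (expItZ Z t : H →L[ℂ] H)) := h
  have hsym : (compression K (expItZ Z t : H →L[ℂ] H) : K →ₗ[ℂ] K).IsSymmetric := by
    rw [hZ.compression_expItZ]
    exact isSymmetric_compression (isSymmetric_cos_expItZ t)
  have hd := hS.orthogonal_eigenspan_sq hsym
  set C := compression K (expItZ Z t : H →L[ℂ] H)
  have hC : ∀ x : K, (C x : H) =
      (1 / 2 : ℂ) • ((expItZ Z t : H →L[ℂ] H) x + (expItZ Z (-t) : H →L[ℂ] H) x) := fun x =>
    hZ.starProjection_expItZ_apply t x.2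
  have hadd : ∀ (a b : ℝ) (x : H), (expItZ Z a : H →L[ℂ] H) ((expItZ Z b : H →L[ℂ] H) x) =
      (expItZ Z (a + b) : H →L[ℂ] H) x := fun a b x =>
    DFunLike.congr_fun (expItZ_mul Z a b) x
  have hC2 : ∀ x : K, ((C * C) x : H) = (1 / 4 : ℂ) • ((expItZ Z (2 * t) : H →L[ℂ] H) x +
      (expItZ Z (-(2 * t)) : H →L[ℂ] H) x + (2 : ℂ) • (x : H)) := fun x => by
    rw [mul_apply_eq_comp, hC, hC]
    simp only [map_smul, map_add, hadd]
    rw [add_neg_cancel, neg_add_cancel, expItZ_zero, ← two_mul, ← neg_add, ← two_mul,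
      one_apply_eq_self]
    module
  -- Eigenvectors of `C²` are total in `K` and lie in `eigenspan Z`, so the projection of `w` to `K`
  -- vanishes.
  have hK : ∀ w ∈ (eigenspan (Z : H →L[ℂ] H))ᗮ, w ∈ Kᗮ := by
    intro w hw
    have h1 : K.orthogonalProjectionOnto w ∈ (eigenspan (C * C))ᗮ :=
      mem_orthogonal_eigenspan fun v μ hv => by
        have h2 := congrArg Subtype.val hv
        rw [hC2, Submodule.coe_smul] at h2
        have h3 : (v : H) ∈ eigenspan (Z : H →L[ℂ] H) := by
          -- `C² v = μ v` says `(e^{2itZ} + e^{-2itZ} + 2) v = 4μ v`.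
          refine mem_eigenspan_of_trigonometric (t := 2 * t) (a := 1) (b := 2 - 4 * μ)
            (by positivity) ?_
          rw [sub_smul, mul_smul, ← h2]
          module
        rw [Submodule.coe_inner, ← Submodule.starProjection_apply,
          ← Submodule.inner_starProjection_left_eq_right,
          Submodule.starProjection_eq_self_iff.mpr v.2]
        exact hw _ h3
    rw [hd, Submodule.mem_bot] at h1
    refine (Submodule.starProjection_apply_eq_zero_iff K).mp ?_
    rw [Submodule.starProjection_apply, h1, Submodule.coe_zero]
  rw [eq_bot_iff]
  intro w hw
  have hZw : (Z : H →L[ℂ] H) w ∈ (eigenspan (Z : H →L[ℂ] H))ᗮ :=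
    mem_orthogonal_eigenspan fun v μ hv => by
      have h1 : inner ℂ v ((Z : H →L[ℂ] H) w) = inner ℂ ((Z : H →L[ℂ] H) v) w :=
        (selfAdjoint.isSymmetric Z v w).symm
      rw [h1, hv, inner_smul_left, inner_eq_zero_of_mem_orthogonal_eigenspan hw hv, mul_zero]
  -- `Z w` lies in `Kᗮ` by `hK` and in `K` by co-diagonality. Being in the kernel, `w` is then
  -- orthogonal to itself.
  have h0 : (Z : H →L[ℂ] H) w = 0 :=
    inner_self_eq_zero (𝕜 := ℂ).mp (hK _ hZw _ (hZ.2 w (hK w hw)))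
  refine (Submodule.mem_bot ℂ).mpr (inner_self_eq_zero (𝕜 := ℂ).mp
    (inner_eq_zero_of_mem_orthogonal_eigenspan (μ := 0) hw ?_))
  rw [h0, zero_smul]

lemma IsCodiagonal.simultaneouslyDiagonalizable (hZ : IsCodiagonal K (Z : H →L[ℂ] H))
    (h : (eigenspan (Z : H →L[ℂ] H))ᗮ = ⊥) :
    SimultaneouslyDiagonalizable
      (Set.range (fun t : ℝ => (expItZ Z t : H →L[ℂ] H)) ∪
        Set.range (fun t : ℝ => geodesicCommutator K Z t)) := by
  obtain ⟨ι, b, hb⟩ := isDiagonalizable_of_isSymmetric (selfAdjoint.isSymmetric Z) h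
  refine ⟨ι, b, ?_⟩
  rintro T (⟨t, rfl⟩ | ⟨t, rfl⟩) i <;> obtain ⟨μ, hμ⟩ := hb i
  · exact ⟨_, expItZ_apply_of_eigenvector hμ t⟩
  · refine ⟨(1 / 4 : ℂ) * (Complex.exp (Complex.I * (-(2 * t) : ℝ) * μ) -
      Complex.exp (Complex.I * (2 * t : ℝ) * μ)), ?_⟩
    beta_reduce
    rw [hZ.geodesicCommutator_eq, smul_apply, sub_apply, expItZ_apply_of_eigenvector hμ,
      expItZ_apply_of_eigenvector hμ]
    module

end GenericPart

theorem mainTheorem5 {H : Type u} [NormedAddCommGroup H] [InnerProductSpace ℂ H] [CompleteSpace H]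
    (L₀ : ClosedSubmodule ℂ H) (Z : selfAdjoint (H →L[ℂ] H))
    (hZ : IsCodiagonal (L₀ : Submodule ℂ H) (Z : H →L[ℂ] H))
    (s : ℝ) (hs : s ≠ 0) :
    (∀ x ∈ halmosGenericPart (L₀ : Submodule ℂ H) (grassmannGeodesic (L₀ : Submodule ℂ H) Z s),
      (Z : H →L[ℂ] H) x ∈
        halmosGenericPart (L₀ : Submodule ℂ H) (grassmannGeodesic (L₀ : Submodule ℂ H) Z s)) ∧
    List.TFAE [
      ∃ t₀ : ℝ, t₀ ≠ 0 ∧ expItZ Z t₀ ∈ Sd (L₀ : Submodule ℂ H),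
      ∀ t : ℝ, expItZ Z t ∈ Sd (L₀ : Submodule ℂ H),
      IsDiagonalizable (exponentGenericPart (L₀ : Submodule ℂ H) Z s)] ∧
    (IsDiagonalizable (exponentGenericPart (L₀ : Submodule ℂ H) Z s) →
      SimultaneouslyDiagonalizable
        (Set.range (fun t : ℝ => (expItZ Z t : H →L[ℂ] H)) ∪
          Set.range (fun t : ℝ => geodesicCommutator (L₀ : Submodule ℂ H) Z t))) := by
  have : CompleteSpace (L₀ : Submodule ℂ H) := L₀.isClosed.completeSpace_coe
  refine ⟨fun x hx => hZ.apply_mem_halmosGenericPart (hZ.isCodiagonal_grassmannGeodesic s) hx,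
    ?_, fun h =>
    hZ.simultaneouslyDiagonalizable (hZ.orthogonal_eigenspan_of_exponentGenericPart hs h)⟩
  tfae_have 1 → 3 := fun ⟨_, ht, h⟩ => hZ.isDiagonalizable_exponentGenericPart s
    (hZ.orthogonal_eigenspan_of_expItZ_mem_Sd ht h)
  tfae_have 3 → 2 := fun h t =>
    hZ.expItZ_mem_Sd (hZ.orthogonal_eigenspan_of_exponentGenericPart hs h) t
  tfae_have 2 → 1 := fun h => ⟨1, one_ne_zero, h 1⟩
  tfae_finish
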